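/- Let $K$ be a countable (finite or countably infinite) compact Hausdorff space, let $C(K)$ be the Banach space of all real-valued continuous functions on $K$ with the supremum norm $\|f\|=\sup_{x\in K}|f(x)|$, and let $B_{C(K)}=\{f\in C(K):\|f\|\le 1\}$ be its closed unit ball, with the metric and the topology given by the norm. Then every non-expansive homeomorphism $F$ of $B_{C(K)}$ onto itself is an isometry: if $F:B_{C(K)}\to B_{C(K)}$ is a homeomorphism with $\|F(f)-F(g)\|\le\|f-g\|$ for all $f,g\in B_{C(K)}$, then $\|F(f)-F(g)\|=\|f-g\|$ for all $f,g\in B_{C(K)}$. -/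

import Mathlib

/-!
Let `F` be a non-expansive homeomorphism of the unit ball of `C(K, ℝ)` and `G` its inverse. The
proof finds a map `τ` from the isolated points of `K` to themselves such that `F h n = h (τ n)` for
all `h` in the ball and all isolated `n`. As `K` is countable, its isolated points are dense by
Baire's theorem; the image of `τ` turns out to be dense too, so `‖F f - F g‖` and `‖f - g‖` are
suprema of the same numbers.

*Sign functions.* A function `x` with values `±1` is an extreme point of the ball, and being within
`1 - a` of `x` means `a ≤ h * x` (`NonexpansivePair.le_map_mul`). Comparing with such points shows
that `G` maps sign functions to sign functions and is odd on them. One may assume `G 1 = 1`. For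
isolated `n`, `G` maps the function with value `-1` at `n` and `1` elsewhere to a function which is
`-1` at exactly one point: the nonnegative functions supported on the set where it is `-1` are
mapped injectively and continuously into a half-line. That point is `τ n`
(`NonexpansivePair.exists_normalizedPair`).

*The half ball.* It is not clear at this stage that `τ` extends to a homeomorphism of `K`, and
general functions cannot be compared with sign functions. But nonnegative ones can be compared with
`1`. Let `f_c` be `1` at `n` and `c` elsewhere. As `c` runs from `1` to `0`, continuity of `G` keeps
`G` nonnegative near `f_c`, and shows that `G f_c` is `1` at `τ n` and `c` elsewhere
(`NormalizedPair.inv_spike`). At `c = 0`, `F` carries `±1` at `τ n`, `0` elsewhere, to the same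
values at `n`. Distances to these points determine `F` on the ball of radius `1 / 2`, and then on
all sign functions (`NormalizedPair.map_isSignFunction`).

*The whole ball.* Fix `c < 1`. If `|h| ≥ c` off `τ n`, then `h` is within `1 - c` of a sign
function, and `F h n` is at least `h (τ n)`, truncated at `c`. Such a bound for all `h` with `|h| ≥
b` determines `G` on functions with absolute values in `[b, c] ∪ {1}`, again by continuity of `G`;
comparing with these extends the bound to all `h` with `|h| ≥ b - (1 - c)`
(`NormalizedPair.LowerBound.step`). Repeating this reaches all nowhere vanishing `h`, and `c → 1`
gives `F h n = h (τ n)` for these. They are dense because `K` is countable.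
-/

open Set Filter Topology

/-! ### Sign functions under a non-expansive bijection -/

/-- `y` takes only the values `1` and `-1`; these functions are the extreme points of the unit ball
of `C(K, ℝ)`. -/
def IsSignFunction {K : Type*} [TopologicalSpace K] (y : C(K, ℝ)) : Prop :=
  ∀ t, y t = 1 ∨ y t = -1

/-- `F` restricts to a non-expansive bijection of the closed unit ball of `C(K, ℝ)`, and `G`
restricts to its inverse, which is continuous. Both are functions on the whole space, with no
condition outside the ball; this avoids coercions from the ball. -/
structure NonexpansivePair {K : Type*} [TopologicalSpace K] [CompactSpace K]
    (F G : C(K, ℝ) → C(K, ℝ)) : Prop where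
  norm_le : ∀ f, ‖f‖ ≤ 1 → ‖F f‖ ≤ 1
  norm_inv_le : ∀ f, ‖f‖ ≤ 1 → ‖G f‖ ≤ 1
  right_inv : ∀ f, ‖f‖ ≤ 1 → F (G f) = f
  left_inv : ∀ f, ‖f‖ ≤ 1 → G (F f) = f
  norm_sub_le : ∀ f g, ‖f‖ ≤ 1 → ‖g‖ ≤ 1 → ‖F f - F g‖ ≤ ‖f - g‖
  continuousOn_inv : ContinuousOn G (Metric.closedBall 0 1)

namespace IsSignFunction

variable {K : Type*} [TopologicalSpace K] {x y : C(K, ℝ)}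

theorem one : IsSignFunction (1 : C(K, ℝ)) := fun _ => Or.inl rfl

theorem neg (hy : IsSignFunction y) : IsSignFunction (-y) := fun t => by
  rcases hy t with h | h <;> simp [h]

theorem mul_self (hy : IsSignFunction y) (t : K) : y t * y t = 1 := by
  rcases hy t with h | h <;> simp [h]

theorem mul_mul_self (hy : IsSignFunction y) (f : C(K, ℝ)) : y * (y * f) = f := by
  ext t
  rw [ContinuousMap.mul_apply, ContinuousMap.mul_apply, ← mul_assoc, hy.mul_self, one_mul]

theorem abs_eq (hy : IsSignFunction y) (t : K) : |y t| = 1 := by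
  rcases hy t with h | h <;> simp [h]

theorem norm_le [CompactSpace K] (hy : IsSignFunction y) : ‖y‖ ≤ 1 :=
  (ContinuousMap.norm_le _ zero_le_one).2 fun t => (hy.abs_eq t).le

theorem norm_mul_le [CompactSpace K] (hy : IsSignFunction y) (f : C(K, ℝ)) : ‖y * f‖ ≤ ‖f‖ :=
  (_root_.norm_mul_le _ _).trans (mul_le_of_le_one_left (norm_nonneg _) hy.norm_le)

end IsSignFunction

section Pointwise

variable {K : Type*} [TopologicalSpace K] [CompactSpace K]

theorem ContinuousMap.abs_apply_le_one {f : C(K, ℝ)} (hf : ‖f‖ ≤ 1) (t : K) : |f t| ≤ 1 :=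
  (f.norm_coe_le_norm t).trans hf

theorem ContinuousMap.abs_sub_apply_le {f g : C(K, ℝ)} {a : ℝ} (h : ‖f - g‖ ≤ a) (t : K) :
    |f t - g t| ≤ a :=
  ((f - g).norm_coe_le_norm t).trans h

theorem ContinuousMap.norm_le_one_iff {f : C(K, ℝ)} : ‖f‖ ≤ 1 ↔ ∀ t, |f t| ≤ 1 :=
  ContinuousMap.norm_le _ zero_le_one

end Pointwise

namespace NonexpansivePair

variable {K : Type*} [TopologicalSpace K] [CompactSpace K] {F G : C(K, ℝ) → C(K, ℝ)}

theorem injOn (P : NonexpansivePair F G) {f g : C(K, ℝ)} (hf : ‖f‖ ≤ 1) (hg : ‖g‖ ≤ 1)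
    (h : F f = F g) : f = g := by
  rw [← P.left_inv f hf, h, P.left_inv g hg]

/-- The origin is the only point whose distance to every point of the ball is at most `1`, and the
image of the origin has this property because `F` is onto. -/
theorem map_zero (P : NonexpansivePair F G) : F 0 = 0 := by
  by_contra h0
  have hpos : 0 < ‖F 0‖ := norm_pos_iff.2 h0
  set y : C(K, ℝ) := -(‖F 0‖⁻¹ • F 0) with hy
  have hy1 : ‖y‖ ≤ 1 := by
    rw [hy, norm_neg, norm_smul, norm_inv, norm_norm, inv_mul_cancel₀ hpos.ne']
  have h1 := P.norm_sub_le (G y) 0 (P.norm_inv_le y hy1) (by simp)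
  rw [P.right_inv y hy1, sub_zero] at h1
  have h2 := h1.trans (P.norm_inv_le y hy1)
  have h3 : y - F 0 = -((‖F 0‖⁻¹ + 1) • F 0) := by rw [hy, add_smul, one_smul]; abel
  rw [h3, norm_neg, norm_smul, Real.norm_of_nonneg (by positivity), add_mul,
    inv_mul_cancel₀ hpos.ne'] at h2
  linarith

theorem norm_map_le (P : NonexpansivePair F G) {f : C(K, ℝ)} (hf : ‖f‖ ≤ 1) : ‖F f‖ ≤ ‖f‖ := by
  simpa [P.map_zero] using P.norm_sub_le f 0 hf (by simp)

/-- For a sign function `x`, the inequality `a ≤ h * x` says that `h` is within `1 - a` of `x`. So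
if `F` maps `x` to a sign function `y`, it carries lower bounds relative to `x` to lower bounds
relative to `y`. -/
theorem le_map_mul (P : NonexpansivePair F G) {x y h : C(K, ℝ)} (hx : IsSignFunction x)
    (hy : IsSignFunction y) (hxy : F x = y) (hh : ‖h‖ ≤ 1) {a : ℝ} (ha : a ≤ 1)
    (hle : ∀ t, a ≤ h t * x t) (t : K) : a ≤ F h t * y t := by
  have h1 : ‖h - x‖ ≤ 1 - a := by
    rw [ContinuousMap.norm_le _ (by linarith)]
    intro s
    have h2 := abs_le.1 (ContinuousMap.abs_apply_le_one hh s)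
    have h3 := hle s
    rw [Real.norm_eq_abs, abs_le]
    rcases hx s with h | h <;> simp only [ContinuousMap.sub_apply, h] at h3 ⊢ <;>
      constructor <;> linarith
  have h2 := (P.norm_sub_le h x hh hx.norm_le).trans h1
  rw [hxy] at h2
  have h3 := abs_le.1 (ContinuousMap.abs_sub_apply_le h2 t)
  rcases hy t with h | h <;> rw [h] at h3 ⊢ <;> linarith

/-- The balls of radius `a` about `0` and of radius `1 - a` about a sign function `y` meet only in
`a • y`. -/
theorem eq_smul_of_norm_le (P : NonexpansivePair F G) {y h : C(K, ℝ)} (hy : IsSignFunction y)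
    {a : ℝ} (ha1 : a ≤ 1) (h0 : ‖h‖ ≤ a) (h1 : ‖h - G y‖ ≤ 1 - a) :
    F h = a • y := by
  have hh : ‖h‖ ≤ 1 := h0.trans ha1
  have h2 := (P.norm_map_le hh).trans h0
  have h3 := (P.norm_sub_le h (G y) hh (P.norm_inv_le y hy.norm_le)).trans h1
  rw [P.right_inv y hy.norm_le] at h3
  ext t
  have h4 := abs_le.1 (((F h).norm_coe_le_norm t).trans h2)
  have h5 := abs_le.1 (ContinuousMap.abs_sub_apply_le h3 t)
  rcases hy t with h | h <;> simp only [h, ContinuousMap.smul_apply, smul_eq_mul] at h5 ⊢ <;>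
    linarith

theorem map_smul_inv (P : NonexpansivePair F G) {y : C(K, ℝ)} (hy : IsSignFunction y)
    {a : ℝ} (ha0 : 0 ≤ a) (ha1 : a ≤ 1) : F (a • G y) = a • y := by
  have hG := P.norm_inv_le y hy.norm_le
  refine P.eq_smul_of_norm_le hy ha1 ?_ ?_
  · rw [norm_smul, Real.norm_of_nonneg ha0]
    exact mul_le_of_le_one_right ha0 hG
  · have : a • G y - G y = -((1 - a) • G y) := by rw [sub_smul, one_smul]; abel
    rw [this, norm_neg, norm_smul, Real.norm_of_nonneg (by linarith)]
    exact mul_le_of_le_one_right (by linarith) hG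

/-- The function `(G y + 1 - |G y|) / 2` is as close to `0` and to `G y` as `G y / 2` is, so both
are mapped to `y / 2`; by injectivity `|G y| = 1`. -/
theorem isSignFunction_inv (P : NonexpansivePair F G) {y : C(K, ℝ)} (hy : IsSignFunction y) :
    IsSignFunction (G y) := by
  have hG := P.norm_inv_le y hy.norm_le
  set h : C(K, ℝ) := (1 / 2 : ℝ) • G y + (1 / 2 : ℝ) • (1 - |G y|) with hdef
  have hval : ∀ t, h t = 1 / 2 * G y t + 1 / 2 * (1 - |G y t|) := fun t => rfl
  have h0 : ‖h‖ ≤ 1 / 2 := by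
    rw [ContinuousMap.norm_le _ (by norm_num)]
    intro t
    have h2 := ContinuousMap.abs_apply_le_one hG t
    rw [Real.norm_eq_abs, hval, abs_le]
    constructor <;> cases abs_cases (G y t) <;> linarith
  have h1 : ‖h - G y‖ ≤ 1 - 1 / 2 := by
    rw [ContinuousMap.norm_le _ (by norm_num)]
    intro t
    have h2 := ContinuousMap.abs_apply_le_one hG t
    rw [Real.norm_eq_abs, ContinuousMap.sub_apply, hval, abs_le]
    constructor <;> cases abs_cases (G y t) <;> linarith
  have h3 := P.eq_smul_of_norm_le hy (by norm_num) h0 h1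
  rw [← P.map_smul_inv hy (by norm_num) (by norm_num)] at h3
  have h4 : h = (1 / 2 : ℝ) • G y := by
    refine P.injOn (h0.trans (by norm_num)) ?_ h3
    rw [norm_smul, Real.norm_of_nonneg (by norm_num)]
    linarith
  intro t
  have h5 := congrArg (fun g : C(K, ℝ) => g t) h4
  simp only [hval, ContinuousMap.smul_apply, smul_eq_mul] at h5
  exact eq_or_eq_neg_of_abs_eq (by linarith)

/-- The midpoint of `G y` and `G (-y)` has nonnegative product with both, so its image has
nonnegative product with both `y` and `-y`: the image is `0`, and hence so is the midpoint. -/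
theorem inv_neg (P : NonexpansivePair F G) {y : C(K, ℝ)} (hy : IsSignFunction y) :
    G (-y) = -G y := by
  have hx := P.isSignFunction_inv hy
  have hz := P.isSignFunction_inv hy.neg
  set h : C(K, ℝ) := (1 / 2 : ℝ) • (G y + G (-y)) with hdef
  have hval : ∀ t, h t = 1 / 2 * (G y t + G (-y) t) := fun t => rfl
  have hh : ‖h‖ ≤ 1 := by
    rw [ContinuousMap.norm_le_one_iff]
    intro t
    rw [hval]
    rcases hx t with h | h <;> rcases hz t with h' | h' <;> rw [h, h'] <;> norm_num
  have h1 := P.le_map_mul (a := 0) hx hy (P.right_inv y hy.norm_le) hh zero_le_one (fun t => by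
    rw [hval]
    rcases hx t with h | h <;> rcases hz t with h' | h' <;> rw [h, h'] <;> norm_num)
  have h2 := P.le_map_mul (a := 0) hz hy.neg (P.right_inv (-y) hy.neg.norm_le) hh zero_le_one
    (fun t => by
      rw [hval]
      rcases hx t with h | h <;> rcases hz t with h' | h' <;> rw [h, h'] <;> norm_num)
  have h3 : F h = F 0 := by
    rw [P.map_zero]
    ext t
    have h4 := h1 t
    have h5 := h2 t
    rw [ContinuousMap.neg_apply] at h5
    rcases hy t with h | h <;> rw [h] at h4 h5 <;> rw [ContinuousMap.zero_apply] <;> linarith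
  have h6 := P.injOn hh (by simp) h3
  ext t
  have h7 := congrArg (fun g : C(K, ℝ) => g t) h6
  simp only [hval, ContinuousMap.zero_apply] at h7
  rw [ContinuousMap.neg_apply]
  linarith

theorem map_one (P : NonexpansivePair F G) (h1 : G 1 = 1) : F 1 = 1 := by
  rw [← h1, P.right_inv 1 IsSignFunction.one.norm_le, h1]

theorem map_nonneg (P : NonexpansivePair F G) (h1 : G 1 = 1) {h : C(K, ℝ)} (hh : ‖h‖ ≤ 1)
    (h0 : ∀ t, 0 ≤ h t) (t : K) : 0 ≤ F h t := by
  simpa using P.le_map_mul IsSignFunction.one IsSignFunction.one (P.map_one h1) hh zero_le_one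
    (fun s => by simpa using h0 s) t

theorem mul_right (P : NonexpansivePair F G) {x : C(K, ℝ)} (hx : IsSignFunction x) :
    NonexpansivePair (fun f => F (x * f)) (fun f => x * G f) := by
  have hxx := hx.mul_mul_self
  have hn := hx.norm_mul_le
  refine ⟨fun f hf => P.norm_le _ ((hn f).trans hf), fun f hf => (hn _).trans (P.norm_inv_le f hf),
    fun f hf => ?_, fun f hf => ?_, fun f g hf hg => ?_, ?_⟩
  · simp only [hxx, P.right_inv f hf]
  · simp only [P.left_inv _ ((hn f).trans hf), hxx]
  · refine (P.norm_sub_le _ _ ((hn f).trans hf) ((hn g).trans hg)).trans ?_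
    rw [← mul_sub]
    exact hn _
  · exact continuousOn_const.mul P.continuousOn_inv

theorem neg_neg (P : NonexpansivePair F G) :
    NonexpansivePair (fun f => -F (-f)) (fun f => -G (-f)) := by
  refine ⟨fun f hf => ?_, fun f hf => ?_, fun f hf => ?_, fun f hf => ?_, fun f g hf hg => ?_, ?_⟩
  · rw [norm_neg]; exact P.norm_le _ (by rwa [norm_neg])
  · rw [norm_neg]; exact P.norm_inv_le _ (by rwa [norm_neg])
  · rw [_root_.neg_neg, P.right_inv _ (by rwa [norm_neg]), _root_.neg_neg]
  · rw [_root_.neg_neg, P.left_inv _ (by rwa [norm_neg]), _root_.neg_neg]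
  · have := P.norm_sub_le (-f) (-g) (by rwa [norm_neg]) (by rwa [norm_neg])
    rwa [neg_sub_neg, norm_sub_rev g f, norm_sub_rev, ← neg_sub_neg] at this
  · refine (P.continuousOn_inv.comp continuousOn_neg fun f hf => ?_).neg
    simpa using hf

end NonexpansivePair

/-! ### Isolated points and the induced map -/

/-- The isolated points of `K`, as a subtype. -/
abbrev IsolatedPoint (K : Type*) [TopologicalSpace K] := {n : K // IsOpen ({n} : Set K)}

/-- By the Baire category theorem: the complements of the countably many non-isolated points are
open and dense. -/
theorem denseRange_isolatedPoint {K : Type*} [TopologicalSpace K] [CompactSpace K] [T2Space K]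
    [Countable K] : DenseRange (Subtype.val : IsolatedPoint K → K) := by
  have h : Dense (⋂ x ∈ {x : K | ¬ IsOpen ({x} : Set K)}, ({x}ᶜ : Set K)) :=
    dense_biInter_of_isOpen (fun x _ => isOpen_compl_singleton) (Set.to_countable _)
      fun x hx => dense_compl_singleton_iff_not_open.2 hx
  refine h.mono fun y hy => ?_
  by_contra hy'
  simp only [mem_iInter] at hy
  exact hy y (fun h => hy' ⟨⟨y, h⟩, rfl⟩) rfl

namespace ContinuousMap

variable {K : Type*} [TopologicalSpace K] [T1Space K]

open Classical in
/-- The continuous function `f` with its value at the isolated point `n` replaced by `a`. -/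
noncomputable def update (f : C(K, ℝ)) (n : IsolatedPoint K) (a : ℝ) : C(K, ℝ) where
  toFun := Function.update f n a
  continuous_toFun := by
    rw [continuous_iff_continuousAt]
    intro t
    by_cases h : t = n
    · subst h
      rw [ContinuousAt, (isOpen_singleton_iff_nhds_eq_pure _).1 n.2]
      exact (tendsto_pure_pure _ _).mono_right (pure_le_nhds _)
    · exact (continuousAt_update_of_ne h).2 f.continuous.continuousAt

@[simp] theorem update_self (f : C(K, ℝ)) (n : IsolatedPoint K) (a : ℝ) : f.update n a n = a :=
  by
  classical exact Function.update_self (n : K) a f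

theorem update_of_ne (f : C(K, ℝ)) {n : IsolatedPoint K} (a : ℝ) {t : K} (h : t ≠ n) :
    f.update n a t = f t :=
  by classical exact Function.update_of_ne h a f

theorem norm_update_le_one [CompactSpace K] {f : C(K, ℝ)} (hf : ‖f‖ ≤ 1) (n : IsolatedPoint K)
    {a : ℝ} (ha : |a| ≤ 1) : ‖f.update n a‖ ≤ 1 := by
  rw [norm_le_one_iff]
  intro t
  by_cases h : t = n
  · rwa [h, update_self]
  · rw [update_of_ne _ _ h]
    exact abs_apply_le_one hf t

end ContinuousMap

theorem IsSignFunction.update {K : Type*} [TopologicalSpace K] [T1Space K] {y : C(K, ℝ)}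
    (hy : IsSignFunction y) (n : IsolatedPoint K) {a : ℝ} (ha : a = 1 ∨ a = -1) :
    IsSignFunction (y.update n a) := fun t => by
  by_cases h : t = n
  · rwa [h, ContinuousMap.update_self]
  · rw [ContinuousMap.update_of_ne _ _ h]
    exact hy t

theorem IsSignFunction.flip {K : Type*} [TopologicalSpace K] [T1Space K] (n : IsolatedPoint K) :
    IsSignFunction (ContinuousMap.update (1 : C(K, ℝ)) n (-1)) :=
  IsSignFunction.one.update n (Or.inr rfl)

/-- A pair `F`, `G` that fixes the constant `1`, together with the map `τ` of isolated points that
`G` induces: flipping the sign of `1` at `n` corresponds under `G` to flipping it at `τ n`. The last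
two fields make continuous functions determined by their values at the isolated points, or at the
image of `τ`. -/
structure NormalizedPair {K : Type*} [TopologicalSpace K] [CompactSpace K] [T2Space K]
    (F G : C(K, ℝ) → C(K, ℝ)) (τ : IsolatedPoint K → IsolatedPoint K) : Prop
    extends NonexpansivePair F G where
  inv_one : G 1 = 1
  inv_flip : ∀ n, G (ContinuousMap.update 1 n (-1)) = ContinuousMap.update 1 (τ n) (-1)
  dense_isolated : DenseRange (Subtype.val : IsolatedPoint K → K)
  dense_image : DenseRange fun n => (τ n : K)

namespace NonexpansivePair

variable {K : Type*} [TopologicalSpace K] [CompactSpace K] [T2Space K]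
  {F G : C(K, ℝ) → C(K, ℝ)}

/-- A nonnegative function supported where `G` sends the flip of `1` at `n` to `-1` is mapped to a
function supported at `n`. -/
theorem map_eq_zero_off (P : NonexpansivePair F G) (h1 : G 1 = 1) (n : IsolatedPoint K)
    {h : C(K, ℝ)} (hh : ‖h‖ ≤ 1) (h0 : ∀ t, 0 ≤ h t)
    (hW : ∀ t, G (ContinuousMap.update 1 n (-1)) t = 1 → h t = 0) {t : K} (ht : t ≠ n) :
    F h t = 0 := by
  have hs := IsSignFunction.flip n
  refine le_antisymm ?_ (P.map_nonneg h1 hh h0 t)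
  have h2 := P.le_map_mul (a := 0) (P.isSignFunction_inv hs.neg) hs.neg
    (P.right_inv _ hs.neg.norm_le) hh zero_le_one (fun s => by
      rw [P.inv_neg hs, ContinuousMap.neg_apply]
      rcases P.isSignFunction_inv hs s with h | h
      · rw [hW s h]; simp
      · rw [h]; simpa using h0 s) t
  rw [ContinuousMap.neg_apply, ContinuousMap.update_of_ne _ _ ht] at h2
  simpa using h2

theorem exists_apply_eq_neg_one (P : NonexpansivePair F G) (h1 : G 1 = 1) (n : IsolatedPoint K) :
    ∃ t, G (ContinuousMap.update 1 n (-1)) t = -1 := by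
  have hs := IsSignFunction.flip n
  by_contra! hne
  have h2 : G (ContinuousMap.update 1 n (-1)) = 1 := by
    ext t
    exact (P.isSignFunction_inv hs t).resolve_right (hne t)
  have h3 := P.right_inv _ hs.norm_le
  rw [h2, P.map_one h1] at h3
  have h4 := congrArg (fun g : C(K, ℝ) => g n) h3
  norm_num at h4

/-- `G` sends the flip of `1` at `n` to `-1` at one point only: given two such points, `F` would map
two segments of nonnegative functions meeting only at `0` injectively into the half-line of
nonnegative functions supported at `n`. -/
theorem eq_of_apply_eq_neg_one (P : NonexpansivePair F G) (h1 : G 1 = 1) (n : IsolatedPoint K)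
    {t u : K} (ht : G (ContinuousMap.update 1 n (-1)) t = -1)
    (hu : G (ContinuousMap.update 1 n (-1)) u = -1) : t = u := by
  by_contra htu
  have hs := IsSignFunction.flip n
  set x := G (ContinuousMap.update 1 n (-1)) with hxdef
  have hx : IsSignFunction x := P.isSignFunction_inv hs
  obtain ⟨v, hv0, hv1, hv⟩ := exists_continuous_zero_one_of_isClosed (isClosed_singleton (x := u))
    (isClosed_singleton (x := t)) (by simpa using Ne.symm htu)
  have hvu : v u = 0 := hv0 rfl
  have hvt : v t = 1 := hv1 rfl
  -- The factor `1 - x` is `0` or `2`, so both functions live on `{x = -1}`; `p` peaks at `t` and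
  -- vanishes at `u`, and `q` the other way round.
  set p : C(K, ℝ) := (1 / 2 : ℝ) • ((1 - x) * v) with hp
  set q : C(K, ℝ) := (1 / 2 : ℝ) • ((1 - x) * (1 - v)) with hq
  have hpv : ∀ s, p s = 1 / 2 * ((1 - x s) * v s) := fun s => rfl
  have hqv : ∀ s, q s = 1 / 2 * ((1 - x s) * (1 - v s)) := fun s => rfl
  have key : ∀ r : C(K, ℝ), (∀ s, 0 ≤ r s ∧ r s ≤ 1) → (∀ s, x s = 1 → r s = 0) →
      ∀ a ∈ Icc (0 : ℝ) 1, ‖a • r‖ ≤ 1 ∧ 0 ≤ F (a • r) n ∧ ∀ s : K, s ≠ n → F (a • r) s = 0 := by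
    intro r hr hr0 a ha
    have hn : ‖a • r‖ ≤ 1 := by
      rw [ContinuousMap.norm_le_one_iff]
      intro s
      rw [ContinuousMap.smul_apply, smul_eq_mul, abs_of_nonneg (mul_nonneg ha.1 (hr s).1)]
      exact mul_le_one₀ ha.2 (hr s).1 (hr s).2
    have hnn : ∀ s, 0 ≤ (a • r) s := fun s => mul_nonneg ha.1 (hr s).1
    refine ⟨hn, P.map_nonneg h1 hn hnn n, fun s hs' => ?_⟩
    refine P.map_eq_zero_off h1 n hn hnn (fun s' h' => ?_) hs'
    rw [ContinuousMap.smul_apply, hr0 s' h', smul_zero]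
  have hpr : ∀ s, 0 ≤ p s ∧ p s ≤ 1 := fun s => by
    rw [hpv]
    have := hv s
    rcases hx s with h | h <;> rw [h] <;> constructor <;> linarith [this.1, this.2]
  have hqr : ∀ s, 0 ≤ q s ∧ q s ≤ 1 := fun s => by
    rw [hqv]
    have := hv s
    rcases hx s with h | h <;> rw [h] <;> constructor <;> linarith [this.1, this.2]
  have hp0 : ∀ s, x s = 1 → p s = 0 := fun s h => by rw [hpv, h]; ring
  have hq0 : ∀ s, x s = 1 → q s = 0 := fun s h => by rw [hqv, h]; ring
  have hcont : ∀ r : C(K, ℝ), (∀ s, 0 ≤ r s ∧ r s ≤ 1) → (∀ s, x s = 1 → r s = 0) →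
      Icc (0 : ℝ) (F r n) ⊆ (fun a : ℝ => F (a • r) n) '' Icc (0 : ℝ) 1 := by
    intro r hr hr0
    have hc : ContinuousOn (fun a : ℝ => F (a • r) n) (Icc 0 1) := by
      have hL : LipschitzOnWith 1 (fun a : ℝ => F (a • r) n) (Icc 0 1) := by
        refine LipschitzOnWith.of_dist_le_mul fun a ha b hb => ?_
        have ha' := (key r hr hr0 a ha).1
        have hb' := (key r hr hr0 b hb).1
        have hr1 : ‖r‖ ≤ 1 := by simpa using (key r hr hr0 1 (by simp)).1
        have h2 := ContinuousMap.abs_sub_apply_le (P.norm_sub_le _ _ ha' hb') n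
        rw [Real.dist_eq, Real.dist_eq, NNReal.coe_one, one_mul]
        refine h2.trans ?_
        rw [← sub_smul, norm_smul]
        exact mul_le_of_le_one_right (norm_nonneg _) hr1
      exact hL.continuousOn
    have h2 := intermediate_value_Icc zero_le_one hc
    simpa [P.map_zero] using h2
  have main : ∀ a ∈ Icc (0 : ℝ) 1, ∀ b ∈ Icc (0 : ℝ) 1, F (a • p) n = F (b • q) n →
      a • p = b • q := by
    intro a ha b hb hab
    refine P.injOn (key p hpr hp0 a ha).1 (key q hqr hq0 b hb).1 ?_
    ext s
    by_cases hs' : s = (n : K)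
    · rw [hs', hab]
    · rw [(key p hpr hp0 a ha).2.2 s hs', (key q hqr hq0 b hb).2.2 s hs']
  have hpt : p t = 1 := by rw [hpv, hvt, ht]; norm_num
  have hpu : p u = 0 := by rw [hpv, hvu]; norm_num
  have hqt : q t = 0 := by rw [hqv, hvt]; norm_num
  have hqu : q u = 1 := by rw [hqv, hvu, hu]; norm_num
  rcases le_total (F p n) (F q n) with hle | hle
  · obtain ⟨b, hb, hb'⟩ := hcont q hqr hq0
      ⟨by simpa using (key p hpr hp0 1 (by simp)).2.1, hle⟩
    have h2 := main 1 (by simp) b hb (by simpa using hb'.symm)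
    have h3 := congrArg (fun g : C(K, ℝ) => g t) h2
    simp [hpt, hqt] at h3
  · obtain ⟨b, hb, hb'⟩ := hcont p hpr hp0
      ⟨by simpa using (key q hqr hq0 1 (by simp)).2.1, hle⟩
    have h2 := main b hb 1 (by simp) (by simpa using hb')
    have h3 := congrArg (fun g : C(K, ℝ) => g u) h2
    simp [hpu, hqu] at h3

theorem exists_normalizedPair (P : NonexpansivePair F G) (h1 : G 1 = 1)
    (hd : DenseRange (Subtype.val : IsolatedPoint K → K)) : ∃ τ, NormalizedPair F G τ := by
  choose σ hσ using P.exists_apply_eq_neg_one h1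
  have hs := IsSignFunction.flip (K := K)
  have hopen : ∀ n, IsOpen ({σ n} : Set K) := by
    intro n
    have h2 : ({σ n} : Set K) = G (ContinuousMap.update 1 n (-1)) ⁻¹' Iio 0 := by
      ext t
      simp only [mem_singleton_iff, mem_preimage, mem_Iio]
      constructor
      · rintro rfl
        rw [hσ]; norm_num
      · intro h
        refine P.eq_of_apply_eq_neg_one h1 n ?_ (hσ n)
        rcases P.isSignFunction_inv (hs n) t with h' | h'
        · rw [h'] at h; norm_num at h
        · exact h'
    rw [h2]
    exact isOpen_Iio.preimage (ContinuousMap.continuous _)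
  have hflip : ∀ n, G (ContinuousMap.update 1 n (-1)) =
      ContinuousMap.update 1 ⟨σ n, hopen n⟩ (-1) := by
    intro n
    ext t
    by_cases h : t = σ n
    · subst h
      rw [hσ]
      exact (ContinuousMap.update_self (1 : C(K, ℝ)) ⟨σ n, hopen n⟩ (-1)).symm
    · rw [ContinuousMap.update_of_ne _ _ h]
      exact (P.isSignFunction_inv (hs n) t).resolve_right
        fun h' => h (P.eq_of_apply_eq_neg_one h1 n h' (hσ n))
  refine ⟨fun n => ⟨σ n, hopen n⟩, P, h1, hflip, hd, ?_⟩
  -- A nonnegative function vanishing on the image of `σ` is mapped to a function vanishing at every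
  -- isolated point, that is, to `0`; so it is `0`.
  by_contra hnd
  obtain ⟨z, hz⟩ : ∃ z, z ∉ closure (range σ) := by
    simpa [DenseRange, Dense] using hnd
  obtain ⟨v, hv0, hv1, hv⟩ := exists_continuous_zero_one_of_isClosed
    (isClosed_closure (s := range σ)) (isClosed_singleton (x := z)) (by simpa using hz)
  have hvn : ‖v‖ ≤ 1 := by
    rw [ContinuousMap.norm_le_one_iff]
    intro s
    rw [abs_of_nonneg (hv s).1]
    exact (hv s).2
  have h3 : F v = F 0 := by
    rw [P.map_zero]
    refine ContinuousMap.ext fun s => ?_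
    refine congrFun (hd.equalizer (F v).continuous (0 : C(K, ℝ)).continuous (funext fun n => ?_)) s
    refine le_antisymm ?_ (P.map_nonneg h1 hvn (fun t => (hv t).1) n)
    have h4 := P.le_map_mul (a := 0) (P.isSignFunction_inv (hs n)) (hs n)
      (P.right_inv _ (hs n).norm_le) hvn zero_le_one (fun t => by
        rw [hflip]
        by_cases h : t = σ n
        · have : v t = 0 := hv0 (subset_closure ⟨n, h.symm⟩)
          rw [this, zero_mul]
        · rw [ContinuousMap.update_of_ne _ _ h]
          simpa using (hv t).1) n
    rw [ContinuousMap.update_self] at h4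
    simpa using h4
  have h5 := P.injOn hvn (by simp) h3
  have h6 : v z = 1 := hv1 rfl
  rw [h5] at h6
  norm_num at h6

end NonexpansivePair

/-! ### The path of spikes -/

namespace ContinuousMap

variable {K : Type*} [TopologicalSpace K] [T1Space K]

theorem update_eq_self (f : C(K, ℝ)) (n : IsolatedPoint K) : f.update n (f n) = f := by
  ext t
  by_cases h : t = n
  · rw [h, update_self]
  · rw [update_of_ne _ _ h]

theorem neg_update (f : C(K, ℝ)) (n : IsolatedPoint K) (a : ℝ) :
    -f.update n a = (-f).update n (-a) := by
  ext t
  by_cases h : t = n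
  · rw [h, neg_apply, update_self, update_self]
  · rw [neg_apply, update_of_ne _ _ h,
      update_of_ne _ _ h, neg_apply]

theorem norm_update_sub_update_le [CompactSpace K] {f g : C(K, ℝ)} {r a b : ℝ} (h : ‖f - g‖ ≤ r)
    (n : IsolatedPoint K) (hab : |a - b| ≤ r) : ‖f.update n a - g.update n b‖ ≤ r := by
  rw [norm_le _ ((norm_nonneg _).trans h)]
  intro t
  by_cases ht : t = n
  · rwa [sub_apply, ht, update_self, update_self]
  · rw [sub_apply, update_of_ne _ _ ht, update_of_ne _ _ ht]
    exact abs_sub_apply_le h t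

end ContinuousMap

namespace NonexpansivePair

variable {K : Type*} [TopologicalSpace K] [CompactSpace K] [T2Space K]
  {F G : C(K, ℝ) → C(K, ℝ)}

/-- If `G (f.update i a) t = a` for values `a` approaching `f i`, then `G f t = f i`, by
continuity of the inverse. -/
theorem inv_apply_eq_of_eventually (P : NonexpansivePair F G) {f : C(K, ℝ)} (hf : ‖f‖ ≤ 1)
    (i : IsolatedPoint K) (t : K) {l : Filter ℝ} [NeBot l] (hl : l ≤ 𝓝 (f i))
    (h : ∀ᶠ a in l, |a| ≤ 1 ∧ G (f.update i a) t = a) : G f t = f i := by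
  have h1 : Tendsto (fun a => f.update i a) l (𝓝[Metric.closedBall 0 1] f) := by
    refine tendsto_nhdsWithin_iff.2 ⟨?_, ?_⟩
    · have h2 : Tendsto (fun a => |a - f i|) l (𝓝 0) := by
        have : Tendsto (fun a => |a - f i|) (𝓝 (f i)) (𝓝 |f i - f i|) := by
          exact ((continuous_id.sub continuous_const).abs).tendsto _
        simpa using this.mono_left hl
      refine tendsto_iff_norm_sub_tendsto_zero.2 (squeeze_zero (fun _ => norm_nonneg _)
        (fun a => ?_) h2)
      conv_lhs => rw [← f.update_eq_self i]
      have := ContinuousMap.norm_update_sub_update_le (f := f) (g := f) (r := |a - f i|)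
        (by simp) i (le_refl |a - f i|)
      rwa [f.update_eq_self i] at this ⊢
    · filter_upwards [h] with a ha
      simpa using ContinuousMap.norm_update_le_one hf i ha.1
  have h2 := (P.continuousOn_inv f (by simpa using hf)).tendsto.comp h1
  have h3 : Tendsto (fun a => G (f.update i a) t) l (𝓝 (G f t)) :=
    ((continuous_eval_const t).tendsto _).comp h2
  have h4 : Tendsto (fun a => G (f.update i a) t) l (𝓝 (f i)) :=
    Tendsto.congr' (by filter_upwards [h] with a ha using ha.2.symm) (tendsto_id.mono_left hl)
  exact tendsto_nhds_unique h3 h4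

end NonexpansivePair

namespace NormalizedPair

variable {K : Type*} [TopologicalSpace K] [CompactSpace K] [T2Space K]
  {F G : C(K, ℝ) → C(K, ℝ)} {τ : IsolatedPoint K → IsolatedPoint K}

theorem map_flip (Q : NormalizedPair F G τ) (n : IsolatedPoint K) :
    F (ContinuousMap.update 1 (τ n) (-1)) = ContinuousMap.update 1 n (-1) := by
  rw [← Q.inv_flip, Q.right_inv _ (IsSignFunction.flip n).norm_le]

theorem injective (Q : NormalizedPair F G τ) : Function.Injective τ := by
  intro n m h
  by_contra hnm
  have h1 := Q.map_flip n
  rw [h, Q.map_flip m] at h1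
  have h2 := congrArg (fun g : C(K, ℝ) => g n) h1
  simp only [ContinuousMap.update_self] at h2
  rw [ContinuousMap.update_of_ne _ _ (fun h => hnm (Subtype.ext h))] at h2
  norm_num at h2

/-- As `τ m` is isolated, the points `τ i` with `i ≠ m` are dense in the complement of `τ m`. -/
theorem mem_of_forall_image_mem (Q : NormalizedPair F G τ) (m : IsolatedPoint K) {C : Set K}
    (hC : IsClosed C) (h : ∀ i, i ≠ m → (τ i : K) ∈ C) {t : K} (ht : t ≠ τ m) : t ∈ C := by
  by_contra htC
  obtain ⟨i, hi⟩ := Q.dense_image.exists_mem_open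
    (hC.isOpen_compl.inter (isOpen_compl_singleton (x := (τ m : K)))) ⟨t, htC, ht⟩
  exact hi.1 (h i fun him => hi.2 (by rw [him]; rfl))

theorem ext_image (Q : NormalizedPair F G τ) {f g : C(K, ℝ)} (h : ∀ n, f (τ n) = g (τ n)) :
    f = g :=
  ContinuousMap.ext fun s =>
    congrFun (Q.dense_image.equalizer f.continuous g.continuous (funext h)) s

theorem ext_isolated (Q : NormalizedPair F G τ) {f g : C(K, ℝ)}
    (h : ∀ n : IsolatedPoint K, f n = g n) : f = g :=
  ContinuousMap.ext fun s =>
    congrFun (Q.dense_isolated.equalizer f.continuous g.continuous (funext h)) s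

theorem map_apply_le (Q : NormalizedPair F G τ) {h : C(K, ℝ)} (hh : ‖h‖ ≤ 1)
    (h0 : ∀ t, 0 ≤ h t) (n : IsolatedPoint K) : F h n ≤ h (τ n) := by
  have h1 := Q.le_map_mul (a := -h (τ n)) (IsSignFunction.flip (τ n)) (IsSignFunction.flip n)
    (Q.map_flip n) hh (by linarith [h0 (τ n)]) (fun t => by
      by_cases ht : t = τ n
      · rw [ht, ContinuousMap.update_self]; linarith
      · rw [ContinuousMap.update_of_ne _ _ ht, ContinuousMap.one_apply]
        linarith [h0 (τ n), h0 t]) n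
  rw [ContinuousMap.update_self] at h1
  linarith

theorem min_le_map_apply (Q : NormalizedPair F G τ) {h : C(K, ℝ)} (hh : ‖h‖ ≤ 1)
    (n : IsolatedPoint K) {c : ℝ} (hc : c ≤ 1) (hle : ∀ t : K, t ≠ τ n → c ≤ h t) :
    min (h (τ n)) c ≤ F h n := by
  have h1 := Q.le_map_mul (a := min (h (τ n)) c) IsSignFunction.one IsSignFunction.one
    (Q.map_one Q.inv_one) hh ((min_le_right _ _).trans hc) (fun t => by
      rw [ContinuousMap.one_apply, mul_one]
      by_cases ht : t = τ n
      · rw [ht]; exact min_le_left _ _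
      · exact (min_le_right _ _).trans (hle t ht)) n
  simpa using h1

/-- If `f` has a value below `c` at `m` only, and `G f` is nonnegative, then `G f` takes that very
value at `τ m`. -/
theorem inv_apply_eq_of_lt (Q : NormalizedPair F G τ) {f : C(K, ℝ)} (hf : ‖f‖ ≤ 1)
    (hpos : ∀ t, 0 ≤ G f t) (m : IsolatedPoint K) {c : ℝ} (hc : c ≤ 1)
    (hle : ∀ t : K, t ≠ (m : K) → c ≤ f t) (hlt : f m < c) : G f (τ m) = f m := by
  have hG := Q.norm_inv_le f hf
  have hup : ∀ i : IsolatedPoint K, f i ≤ G f (τ i) := fun i => by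
    simpa [Q.right_inv f hf] using Q.map_apply_le hG hpos i
  have h1 : ∀ t : K, t ≠ τ m → c ≤ G f t := fun t ht =>
    Q.mem_of_forall_image_mem m (isClosed_le continuous_const (G f).continuous)
      (fun i hi => (hle i fun h => hi (Subtype.ext h)).trans (hup i)) ht
  have h2 := Q.min_le_map_apply hG m hc h1
  rw [Q.right_inv f hf] at h2
  rcases min_le_iff.1 h2 with h | h
  · exact le_antisymm h (hup m)
  · linarith

/-- `G` maps the function that is `1` at `n` and `c` elsewhere to the corresponding function at `τ
n`, as soon as `G` is nonnegative near it: lower the value at one further point `i` slightly below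
`c`, apply `inv_apply_eq_of_lt`, and pass to the limit. -/
theorem inv_spike_of_nonneg (Q : NormalizedPair F G τ) (n : IsolatedPoint K) {c ρ : ℝ}
    (hc0 : 0 ≤ c) (hc1 : c ≤ 1) (hρ : 0 < ρ)
    (hpos : ∀ f : C(K, ℝ), ‖f‖ ≤ 1 → ‖f - (ContinuousMap.const K c).update n 1‖ < ρ →
      ∀ t, 0 ≤ G f t) :
    G ((ContinuousMap.const K c).update n 1) = (ContinuousMap.const K c).update (τ n) 1 := by
  set f : C(K, ℝ) := (ContinuousMap.const K c).update n 1 with hfdef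
  have hf : ‖f‖ ≤ 1 := ContinuousMap.norm_update_le_one
    (ContinuousMap.norm_le_one_iff.2 fun t => by
      rw [ContinuousMap.const_apply, abs_of_nonneg hc0]; exact hc1) n (by simp)
  have hfn : f n = 1 := ContinuousMap.update_self _ _ _
  have hfi : ∀ {t : K}, t ≠ n → f t = c := fun h => ContinuousMap.update_of_ne _ _ h
  refine Q.ext_image fun i => ?_
  by_cases hi : i = n
  · subst hi
    rw [ContinuousMap.update_self]
    have hG := Q.norm_inv_le f hf
    have h1 := Q.map_apply_le hG (hpos f hf (by simpa using hρ)) i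
    rw [Q.right_inv f hf, hfn] at h1
    exact le_antisymm (abs_le.1 (ContinuousMap.abs_apply_le_one hG _)).2 h1
  · have hi' : (i : K) ≠ n := fun h => hi (Subtype.ext h)
    rw [ContinuousMap.update_of_ne _ _ (fun h => hi (Q.injective (Subtype.ext h))),
      ContinuousMap.const_apply]
    have h2 : G f (τ i) = f i := by
      refine Q.inv_apply_eq_of_eventually (l := 𝓝[<] c) hf i _ ?_ ?_
      · rw [hfi hi']; exact nhdsWithin_le_nhds
      · filter_upwards [self_mem_nhdsWithin, mem_nhdsWithin_of_mem_nhds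
          (Ioi_mem_nhds (sub_lt_self c hρ)), mem_nhdsWithin_of_mem_nhds
          (Ioi_mem_nhds (sub_lt_self c one_pos))] with a hac haρ ha1
        simp only [mem_Iio, mem_Ioi] at hac haρ ha1
        have ha : |a| ≤ 1 := abs_le.2 ⟨by linarith, by linarith⟩
        have hu := ContinuousMap.norm_update_le_one hf i ha
        refine ⟨ha, ?_⟩
        have h3 := Q.inv_apply_eq_of_lt hu (hpos _ hu ?_) i hc1 (fun t ht => ?_) ?_
        · rwa [ContinuousMap.update_self] at h3
        · have h4 := ContinuousMap.norm_update_sub_update_le (f := f) (g := f) (r := c - a)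
            (by simp; linarith) i (a := a) (b := f i)
            (by rw [hfi hi', abs_sub_comm, abs_of_nonneg (by linarith)])
          rw [f.update_eq_self] at h4
          linarith
        · rw [ContinuousMap.update_of_ne _ _ ht]
          by_cases htn : t = n
          · rw [htn, hfn]; exact hc1
          · rw [hfi htn]
        · rwa [ContinuousMap.update_self]
    rw [h2, hfi hi']

/-- Along the path where `c` decreases from `1` to `0`, the set of good `c` is closed, and it
extends below any good `c > 0` because there the image is at least `c`, so that `G` stays
nonnegative nearby. -/
theorem inv_spike (Q : NormalizedPair F G τ) (n : IsolatedPoint K) {c : ℝ}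
    (hc : c ∈ Icc (0 : ℝ) 1) :
    G ((ContinuousMap.const K c).update n 1) = (ContinuousMap.const K c).update (τ n) 1 := by
  -- The parameter is `s = 1 - c`, so that the induction on the interval goes upwards.
  set f : IsolatedPoint K → ℝ → C(K, ℝ) :=
    fun m s => (ContinuousMap.const K (1 - s)).update m 1 with hfdef
  have hfd : ∀ m s s', ‖f m s - f m s'‖ ≤ |s - s'| := fun m s s' =>
    ContinuousMap.norm_update_sub_update_le
      ((ContinuousMap.norm_le _ (abs_nonneg _)).2 fun t => by
        rw [ContinuousMap.sub_apply, ContinuousMap.const_apply, ContinuousMap.const_apply,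
          Real.norm_eq_abs, sub_sub_sub_cancel_left, abs_sub_comm]) m (by simp)
  have hfc : ∀ m, Continuous (f m) := fun m =>
    (LipschitzWith.of_dist_le_mul (K := 1) fun s s' => by
      rw [dist_eq_norm, Real.dist_eq, NNReal.coe_one, one_mul]; exact hfd m s s').continuous
  have hfn : ∀ m, ∀ s ∈ Icc (0 : ℝ) 1, ‖f m s‖ ≤ 1 := fun m s hs =>
    ContinuousMap.norm_update_le_one (ContinuousMap.norm_le_one_iff.2 fun t => by
      rw [ContinuousMap.const_apply, abs_le]
      constructor <;> linarith [hs.1, hs.2]) m (by simp)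
  have hsub : Icc (0 : ℝ) 1 ⊆ {s | G (f n s) = f (τ n) s} := by
    refine IsClosed.Icc_subset_of_forall_mem_nhdsWithin ?_ ?_ ?_
    · have hGc : ContinuousOn (fun s => G (f n s)) (Icc 0 1) :=
        Q.continuousOn_inv.comp (hfc n).continuousOn fun s hs => by simpa using hfn n s hs
      have := (hGc.sub (hfc (τ n)).continuousOn).preimage_isClosed_of_isClosed isClosed_Icc
        (isClosed_singleton (x := (0 : C(K, ℝ))))
      rw [inter_comm]
      convert this using 2
      ext s
      simp [sub_eq_zero]
    · have h1 : ∀ m : IsolatedPoint K, f m 0 = 1 := fun m => by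
        ext t
        by_cases ht : t = m
        · simp [hfdef, ht]
        · simp [hfdef, ContinuousMap.update_of_ne _ _ ht]
      rw [mem_ofPred_eq, h1, h1, Q.inv_one]
    · rintro s ⟨hs, hs0, hs1⟩
      have hsI : s ∈ Icc (0 : ℝ) 1 := ⟨hs0, hs1.le⟩
      obtain ⟨ρ, hρ, hρ'⟩ := Metric.continuousOn_iff.1 Q.continuousOn_inv (f n s)
        (by simpa using hfn n s hsI) (1 - s) (by linarith)
      filter_upwards [Ioo_mem_nhdsGT (show s < min 1 (s + ρ / 2) by
        rw [lt_min_iff]; constructor <;> linarith)] with r hr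
      have hr1 := hr.2.trans_le (min_le_left _ _)
      have hr2 := hr.2.trans_le (min_le_right _ _)
      refine Q.inv_spike_of_nonneg n (c := 1 - r) (by linarith) (by linarith [hr.1])
        (half_pos hρ) fun g hg hgr t => ?_
      have h1 : dist g (f n s) < ρ := by
        rw [dist_eq_norm]
        have h2 := hfd n r s
        rw [abs_of_pos (by linarith [hr.1])] at h2
        have h3 := norm_sub_le_norm_sub_add_norm_sub g (f n r) (f n s)
        have h4 : ‖g - f n r‖ < ρ / 2 := hgr
        linarith
      have h2 := hρ' g (by simpa using hg) h1
      rw [dist_eq_norm, show G (f n s) = f (τ n) s from hs] at h2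
      have h3 := (abs_lt.1 ((abs_le.2 (abs_le.1
        (ContinuousMap.abs_sub_apply_le le_rfl t))).trans_lt h2)).1
      have h4 : 1 - s ≤ f (τ n) s t := by
        by_cases ht : t = τ n
        · rw [ht, ContinuousMap.update_self]; linarith
        · rw [hfdef]; simp only
          rw [ContinuousMap.update_of_ne _ _ ht, ContinuousMap.const_apply]
      linarith
  have h := hsub (show 1 - c ∈ Icc (0 : ℝ) 1 from ⟨by linarith [hc.2], by linarith [hc.1]⟩)
  simpa only [hfdef, mem_ofPred_eq, sub_sub_cancel] using h

/-! ### Values on the half ball and at sign functions -/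

theorem map_single_one (Q : NormalizedPair F G τ) (n : IsolatedPoint K) :
    F (ContinuousMap.update 0 (τ n) 1) = ContinuousMap.update 0 n 1 := by
  have h : G (ContinuousMap.update 0 n 1) = ContinuousMap.update 0 (τ n) 1 :=
    Q.inv_spike n (c := 0) (by simp)
  rw [← h, Q.right_inv]
  exact ContinuousMap.norm_update_le_one (by simp) n (by simp)

theorem neg_neg (Q : NormalizedPair F G τ) :
    NormalizedPair (fun f => -F (-f)) (fun f => -G (-f)) τ := by
  refine ⟨Q.toNonexpansivePair.neg_neg, ?_, fun n => ?_, Q.dense_isolated, Q.dense_image⟩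
  · rw [Q.inv_neg IsSignFunction.one, _root_.neg_neg, Q.inv_one]
  · rw [Q.inv_neg (IsSignFunction.flip n), _root_.neg_neg, Q.inv_flip]

theorem map_single_neg_one (Q : NormalizedPair F G τ) (n : IsolatedPoint K) :
    F (ContinuousMap.update 0 (τ n) (-1)) = ContinuousMap.update 0 n (-1) := by
  have h := Q.neg_neg.map_single_one n
  rw [ContinuousMap.neg_update, neg_zero, neg_eq_iff_eq_neg, ContinuousMap.neg_update, neg_zero] at h
  exact h

/-- When `‖h‖ ≤ 1 / 2`, the distances from `h` to the two functions `±1` at `τ n` and `0` elsewhere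
are `1 ∓ h (τ n)`, and they determine the value of `F h` at `n`. -/
theorem map_apply_of_norm_le_half (Q : NormalizedPair F G τ) {h : C(K, ℝ)} (hh : ‖h‖ ≤ 1 / 2)
    (n : IsolatedPoint K) : F h n = h (τ n) := by
  have hb : ∀ t, |h t| ≤ 1 / 2 := fun t => (h.norm_coe_le_norm t).trans hh
  have h1 : ∀ ε : ℝ, ε = 1 ∨ ε = -1 →
      ‖h - ContinuousMap.update 0 (τ n) ε‖ ≤ 1 - ε * h (τ n) := by
    intro ε hε
    have h2 := abs_le.1 (hb (τ n))
    rw [ContinuousMap.norm_le _ (by rcases hε with rfl | rfl <;> linarith)]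
    intro t
    by_cases ht : t = τ n
    · rw [ContinuousMap.sub_apply, ht, ContinuousMap.update_self, Real.norm_eq_abs, abs_le]
      rcases hε with rfl | rfl <;> constructor <;> linarith
    · have h3 := abs_le.1 (hb t)
      rw [ContinuousMap.sub_apply, ContinuousMap.update_of_ne _ _ ht, ContinuousMap.zero_apply,
        Real.norm_eq_abs, abs_le]
      rcases hε with rfl | rfl <;> constructor <;> linarith
  have hn : ∀ ε : ℝ, ε = 1 ∨ ε = -1 → ‖ContinuousMap.update (0 : C(K, ℝ)) (τ n) ε‖ ≤ 1 :=
    fun ε hε => ContinuousMap.norm_update_le_one (by simp) _ (by rcases hε with rfl | rfl <;> simp)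
  have hh1 : ‖h‖ ≤ 1 := hh.trans (by norm_num)
  have hp := (Q.norm_sub_le h _ hh1 (hn 1 (Or.inl rfl))).trans (h1 1 (Or.inl rfl))
  have hm := (Q.norm_sub_le h _ hh1 (hn (-1) (Or.inr rfl))).trans (h1 (-1) (Or.inr rfl))
  rw [Q.map_single_one] at hp
  rw [Q.map_single_neg_one] at hm
  have hp' := (abs_le.1 (ContinuousMap.abs_sub_apply_le hp n)).1
  have hm' := (abs_le.1 (ContinuousMap.abs_sub_apply_le hm n)).2
  rw [ContinuousMap.update_self] at hp' hm'
  linarith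

/-- The half ball, where `F` is known, provides for each `p` a continuous function that represents
`p ∘ τ`. Only on isolated points is `τ` defined, so continuity is the issue. -/
theorem exists_apply_eq (Q : NormalizedPair F G τ) {p : C(K, ℝ)} (hp : ‖p‖ ≤ 1) :
    ∃ f : C(K, ℝ), ‖f‖ ≤ 1 ∧ (∀ n : IsolatedPoint K, f n = p (τ n)) := by
  have h1 : ‖(1 / 2 : ℝ) • p‖ ≤ 1 / 2 := by
    rw [norm_smul, Real.norm_of_nonneg (by norm_num)]; linarith
  refine ⟨(2 : ℝ) • F ((1 / 2 : ℝ) • p), ?_, fun n => ?_⟩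
  · have := Q.norm_map_le (h1.trans (by norm_num))
    rw [norm_smul, Real.norm_of_nonneg (by norm_num)]
    linarith
  · rw [ContinuousMap.smul_apply, Q.map_apply_of_norm_le_half h1, ContinuousMap.smul_apply,
      smul_smul]
    norm_num

theorem map_isSignFunction (Q : NormalizedPair F G τ) {x : C(K, ℝ)} (hx : IsSignFunction x) :
    IsSignFunction (F x) ∧ ∀ n : IsolatedPoint K, F x n = x (τ n) := by
  obtain ⟨y, -, hyx⟩ := Q.exists_apply_eq hx.norm_le
  have hy : IsSignFunction y := by
    have h1 : ∀ t, y t * y t = 1 := fun t =>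
      congrFun (Q.dense_isolated.equalizer (y.continuous.mul y.continuous)
        (continuous_const (y := (1 : ℝ))) (funext fun n => by
          simp only [Function.comp_apply, Pi.mul_apply]
          rw [hyx, hx.mul_self])) t
    exact fun t => mul_self_eq_one_iff.1 (h1 t)
  have hxn : ‖(1 / 2 : ℝ) • x‖ ≤ 1 / 2 := by
    rw [norm_smul, Real.norm_of_nonneg (by norm_num)]
    linarith [hx.norm_le]
  have hG : G y = x := by
    have h2 : (1 / 2 : ℝ) • G y = (1 / 2 : ℝ) • x := by
      refine Q.injOn ?_ (hxn.trans (by norm_num)) ?_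
      · rw [norm_smul, Real.norm_of_nonneg (by norm_num)]
        linarith [Q.norm_inv_le y hy.norm_le]
      · rw [Q.map_smul_inv hy (by norm_num) (by norm_num)]
        refine Q.ext_isolated fun n => ?_
        rw [Q.map_apply_of_norm_le_half hxn, ContinuousMap.smul_apply, ContinuousMap.smul_apply,
          hyx]
    exact smul_right_injective _ (by norm_num : (1 / 2 : ℝ) ≠ 0) h2
  have hF : F x = y := by rw [← hG, Q.right_inv y hy.norm_le]
  exact ⟨hF ▸ hy, hF ▸ hyx⟩

end NormalizedPair

/-! ### Nowhere vanishing functions -/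

namespace ContinuousMap

variable {K : Type*} [TopologicalSpace K]

theorem exists_isSignFunction_mul_eq_abs {h : C(K, ℝ)} (h0 : ∀ t, h t ≠ 0) :
    ∃ x : C(K, ℝ), IsSignFunction x ∧ ∀ t, h t * x t = |h t| := by
  refine ⟨⟨fun t => h t / |h t|, h.continuous.div h.continuous.abs
    fun t => abs_ne_zero.2 (h0 t)⟩, fun t => ?_, fun t => ?_⟩
  · rcases (h0 t).lt_or_gt with ht | ht
    · right
      simp [abs_of_neg ht, (h0 t)]
    · left
      simp [abs_of_pos ht, (h0 t)]
  · have := abs_ne_zero.2 (h0 t)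
    simp only [coe_mk]
    field_simp
    rw [sq_abs]

/-- Nowhere vanishing functions are dense in the ball: as `K` is countable, all but countably many
constants can be added without creating a zero. -/
theorem exists_forall_ne_zero_norm_sub_le [CompactSpace K] [Countable K] {h : C(K, ℝ)}
    (hh : ‖h‖ ≤ 1) {η : ℝ} (hη : 0 < η) :
    ∃ g : C(K, ℝ), ‖g‖ ≤ 1 ∧ (∀ t, g t ≠ 0) ∧ ‖g - h‖ ≤ η := by
  set δ := min η 1 / 2 with hδ
  have hδ0 : 0 < δ := half_pos (lt_min hη one_pos)
  have hδ1 : δ ≤ 1 / 2 := by have := min_le_right η 1; linarith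
  have hδη : δ ≤ η / 2 := by have := min_le_left η 1; linarith
  obtain ⟨c, hc, hc0, hcδ⟩ :=
    ((countable_range fun t => -((1 - δ) * h t)).dense_compl ℝ).exists_between hδ0
  refine ⟨(1 - δ) • h + const K c, ?_, fun t ht => hc ⟨t, ?_⟩, ?_⟩
  · rw [norm_le_one_iff]
    intro t
    have h1 := abs_le.1 (abs_apply_le_one hh t)
    rw [add_apply, smul_apply, const_apply, smul_eq_mul, abs_le]
    constructor <;> nlinarith [h1.1, h1.2]
  · rw [add_apply, smul_apply, const_apply, smul_eq_mul] at ht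
    simp only
    linarith
  · rw [norm_le _ hη.le]
    intro t
    have h1 := abs_le.1 (abs_apply_le_one hh t)
    rw [sub_apply, add_apply, smul_apply, const_apply, smul_eq_mul, Real.norm_eq_abs, abs_le]
    constructor <;> nlinarith [h1.1, h1.2]

end ContinuousMap

namespace NormalizedPair

variable {K : Type*} [TopologicalSpace K] [CompactSpace K] [T2Space K]
  {F G : C(K, ℝ) → C(K, ℝ)} {τ : IsolatedPoint K → IsolatedPoint K}

theorem mul_map_apply_le_of_ne_zero (Q : NormalizedPair F G τ) {h : C(K, ℝ)} (hh : ‖h‖ ≤ 1)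
    (h0 : ∀ t, h t ≠ 0) (n : IsolatedPoint K) {ε : ℝ} (hε : ε = 1 ∨ ε = -1) :
    ε * F h n ≤ max (ε * h (τ n)) 0 := by
  obtain ⟨x, hx, hxh⟩ := ContinuousMap.exists_isSignFunction_mul_eq_abs h0
  have hε' : -ε = 1 ∨ -ε = -1 := by rcases hε with h | h <;> simp [h]
  have hz := hx.update (τ n) hε'
  obtain ⟨hFz, hFzn⟩ := Q.map_isSignFunction hz
  have h1 := Q.le_map_mul (a := -max (ε * h (τ n)) 0) hz hFz rfl hh
    (by linarith [le_max_right (ε * h (τ n)) 0]) (fun t => by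
      by_cases ht : t = τ n
      · rw [ht, ContinuousMap.update_self]
        linarith [le_max_left (ε * h (τ n)) 0]
      · rw [ContinuousMap.update_of_ne _ _ ht, hxh]
        linarith [le_max_right (ε * h (τ n)) 0, abs_nonneg (h t)]) n
  rw [hFzn, ContinuousMap.update_self] at h1
  linarith

/-- The value of `F h` at `n` lies between `0` and `h (τ n)`. -/
theorem mul_map_apply_le [Countable K] (Q : NormalizedPair F G τ) {h : C(K, ℝ)} (hh : ‖h‖ ≤ 1)
    (n : IsolatedPoint K) {ε : ℝ} (hε : ε = 1 ∨ ε = -1) :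
    ε * F h n ≤ max (ε * h (τ n)) 0 := by
  refine le_of_forall_pos_le_add fun η hη => ?_
  obtain ⟨g, hg, hg0, hgh⟩ := ContinuousMap.exists_forall_ne_zero_norm_sub_le hh (half_pos hη)
  have h1 := Q.mul_map_apply_le_of_ne_zero hg hg0 n hε
  have h2 := abs_le.1 (ContinuousMap.abs_sub_apply_le hgh (τ n))
  have h3 := abs_le.1 (ContinuousMap.abs_sub_apply_le ((Q.norm_sub_le g h hg hh).trans hgh) n)
  have h4 : ε * F h n ≤ ε * F g n + η / 2 := by rcases hε with rfl | rfl <;> linarith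
  have h5 : ε * g (τ n) ≤ ε * h (τ n) + η / 2 := by rcases hε with rfl | rfl <;> linarith
  have h6 : max (ε * g (τ n)) 0 ≤ max (ε * h (τ n)) 0 + η / 2 :=
    max_le (by linarith [le_max_left (ε * h (τ n)) 0]) (by linarith [le_max_right (ε * h (τ n)) 0])
  linarith

/-! ### Lowering the threshold -/

/-- If `h` has a sign `x` and absolute value at least `b` off `τ n`, then the value of `F h` at `n`,
up to a sign `ε`, is at least that of `h` at `τ n`, truncated at `c`. The statement gets stronger as
`b` decreases and as `c` increases. -/
def LowerBound (F : C(K, ℝ) → C(K, ℝ)) (τ : IsolatedPoint K → IsolatedPoint K) (c b : ℝ) : Prop :=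
  ∀ (h x : C(K, ℝ)) (n : IsolatedPoint K) (ε : ℝ), ‖h‖ ≤ 1 → IsSignFunction x → (ε = 1 ∨ ε = -1) →
    (∀ t : K, t ≠ τ n → b ≤ h t * x t) → min (ε * h (τ n)) c ≤ ε * F h n

/-- A lower bound for `F h` at `n` from a function `p` whose value `ε` at `τ n` is known to be
carried to `n`, and which is within `1 - c` of `h` elsewhere. -/
theorem min_le_mul_map_apply (Q : NormalizedPair F G τ) {h p : C(K, ℝ)} (hh : ‖h‖ ≤ 1)
    (hp : ‖p‖ ≤ 1) (n : IsolatedPoint K) {ε c : ℝ} (hε : ε = 1 ∨ ε = -1) (hc : c ≤ 1)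
    (hpn : p (τ n) = ε) (hFp : F p n = ε) (hhp : ∀ t : K, t ≠ τ n → |h t - p t| ≤ 1 - c) :
    min (ε * h (τ n)) c ≤ ε * F h n := by
  have h1 : ‖h - p‖ ≤ 1 - min (ε * h (τ n)) c := by
    rw [ContinuousMap.norm_le _ (by linarith [min_le_right (ε * h (τ n)) c])]
    intro t
    rw [ContinuousMap.sub_apply, Real.norm_eq_abs]
    by_cases ht : t = τ n
    · have h2 := abs_le.1 (ContinuousMap.abs_apply_le_one hh (τ n))
      have h3 := min_le_left (ε * h (τ n)) c
      rw [ht, hpn, abs_le]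
      rcases hε with rfl | rfl <;> constructor <;> linarith
    · exact (hhp t ht).trans (by linarith [min_le_right (ε * h (τ n)) c])
  have h2 := abs_le.1 (ContinuousMap.abs_sub_apply_le ((Q.norm_sub_le h p hh hp).trans h1) n)
  rw [hFp] at h2
  rcases hε with rfl | rfl <;> linarith

theorem lowerBound_self (Q : NormalizedPair F G τ) {c : ℝ} (hc : c ≤ 1) : LowerBound F τ c c := by
  intro h x n ε hh hx hε hle
  have hp := hx.update (τ n) hε
  refine Q.min_le_mul_map_apply hh hp.norm_le n hε hc (ContinuousMap.update_self _ _ _) ?_ ?_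
  · rw [(Q.map_isSignFunction hp).2, ContinuousMap.update_self]
  · intro t ht
    have h1 := hle t ht
    have h2 := abs_le.1 (ContinuousMap.abs_apply_le_one hh t)
    rw [ContinuousMap.update_of_ne _ _ ht, abs_le]
    rcases hx t with h | h <;> rw [h] at h1 ⊢ <;> constructor <;> linarith

/-- If `|p|` has values in `[b, c] ∪ {1}` and `f` represents `p ∘ τ`, the lower bound at level `b`
gives `G f = p`. A value `c` is first moved slightly below `c`, where the truncation at `c` is
harmless, and the limit uses continuity of `G`. -/
theorem inv_eq_of_lowerBound [Countable K] (Q : NormalizedPair F G τ) {b c : ℝ}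
    (hL : LowerBound F τ c b) (hb : 0 < b) {f p x : C(K, ℝ)} (hf : ‖f‖ ≤ 1)
    (hfp : ∀ n : IsolatedPoint K, f n = p (τ n)) (hx : IsSignFunction x)
    (hbp : ∀ t, b ≤ p t * x t) (hpc : ∀ t, p t * x t ≤ c ∨ p t * x t = 1) : G f = p := by
  have hup : ∀ g : C(K, ℝ), ‖g‖ ≤ 1 → ∀ j : IsolatedPoint K, 0 < g j * x (τ j) →
      g j * x (τ j) ≤ G g (τ j) * x (τ j) := by
    intro g hg j hj
    have h1 := Q.mul_map_apply_le (Q.norm_inv_le g hg) j (hx (τ j))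
    rw [Q.right_inv g hg, mul_comm, mul_comm (x _)] at h1
    exact (le_max_iff.1 h1).resolve_right (not_le.2 hj)
  refine Q.ext_image fun i => ?_
  rw [← hfp]
  have hfi : b ≤ f i * x (τ i) := hfp i ▸ hbp _
  rcases hpc (τ i) with hi | hi
  · refine Q.inv_apply_eq_of_eventually (l := Filter.map (fun s => s * x (τ i))
      (𝓝[<] (f i * x (τ i)))) hf i _ ?_ ?_
    · have h1 : Tendsto (fun s => s * x (τ i)) (𝓝 (f i * x (τ i))) (𝓝 (f i * x (τ i) * x (τ i))) :=
        (continuous_id.mul continuous_const).tendsto _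
      rw [mul_assoc, hx.mul_self, mul_one] at h1
      exact h1.mono_left nhdsWithin_le_nhds
    · rw [eventually_map]
      filter_upwards [self_mem_nhdsWithin, mem_nhdsWithin_of_mem_nhds
        (Ioi_mem_nhds (hb.trans_le hfi))] with s hs hs0
      simp only [mem_Iio, mem_Ioi] at hs hs0
      have h1 := abs_le.1 (ContinuousMap.abs_apply_le_one hf i)
      have hs1 : |s * x (τ i)| ≤ 1 := by
        rw [abs_le]
        rcases hx (τ i) with h | h <;> rw [h] at hs ⊢ <;> constructor <;> linarith
      have hss : s * x (τ i) * x (τ i) = s := by rw [mul_assoc, hx.mul_self, mul_one]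
      have hg := ContinuousMap.norm_update_le_one hf i hs1
      refine ⟨hs1, ?_⟩
      set g := f.update i (s * x (τ i)) with hgdef
      have hgi : g i = s * x (τ i) := ContinuousMap.update_self _ _ _
      have h2 : s ≤ G g (τ i) * x (τ i) := by
        have := hup g hg i (by rw [hgi, hss]; exact hs0)
        rwa [hgi, hss] at this
      have h3 : ∀ t : K, t ≠ τ i → b ≤ G g t * x t := fun t ht =>
        Q.mem_of_forall_image_mem i
          (isClosed_le continuous_const ((G g).continuous.mul x.continuous)) (fun j hj => by
            have hgj : g j = f j :=
              ContinuousMap.update_of_ne _ _ fun h => hj (Subtype.ext h)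
            have hfj : b ≤ g j * x (τ j) := by rw [hgj, hfp]; exact hbp _
            exact hfj.trans (hup g hg j (hb.trans_le hfj))) ht
      have h4 := hL (G g) x i (x (τ i)) (Q.norm_inv_le g hg) hx (hx _) h3
      rw [Q.right_inv g hg, hgi, mul_comm (x _) (s * _), hss, mul_comm (x _)] at h4
      rw [← hfp] at hi
      have h5 : G g (τ i) * x (τ i) = s := by
        rcases min_le_iff.1 h4 with h | h
        · exact le_antisymm h h2
        · linarith
      rw [← h5, mul_assoc, hx.mul_self, mul_one]
  · have h1 := hup f hf i (hb.trans_le hfi)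
    rw [← hfp] at hi
    rw [hi] at h1
    have h2 := abs_le.1 (ContinuousMap.abs_apply_le_one (Q.norm_inv_le f hf) (τ i))
    rcases hx (τ i) with h | h <;> rw [h] at h1 hi <;> linarith

/-- Truncating `|h|` to `[b, c]` off `τ n` moves `h` by at most `1 - c`, and the truncated function
with value `ε` at `τ n` is covered by `inv_eq_of_lowerBound`. So the threshold `b` can be lowered by
`1 - c`. -/
theorem LowerBound.step [Countable K] (Q : NormalizedPair F G τ) {b b' c : ℝ}
    (hL : LowerBound F τ c b) (hb : 0 < b) (hbc : b ≤ c) (hc : c ≤ 1) (hb' : b - (1 - c) ≤ b') :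
    LowerBound F τ c b' := by
  intro h x n ε hh hx hε hle
  set q : C(K, ℝ) := x * (ContinuousMap.const K b ⊔ ((h * x) ⊓ ContinuousMap.const K c)) with hq
  have hqv : ∀ t, q t = x t * max b (min (h t * x t) c) := fun t => rfl
  have hqx : ∀ t, q t * x t = max b (min (h t * x t) c) := fun t => by
    rw [hqv, mul_comm, ← mul_assoc, hx.mul_self, one_mul]
  have hqc : ∀ t, max b (min (h t * x t) c) ≤ c := fun t => max_le hbc (min_le_right _ _)
  have hqb : ∀ t, b ≤ max b (min (h t * x t) c) := fun t => le_max_left _ _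
  have hqn : ‖q‖ ≤ 1 := by
    rw [ContinuousMap.norm_le_one_iff]
    intro t
    rw [hqv, abs_mul, hx.abs_eq, one_mul, abs_of_pos (hb.trans_le (hqb t))]
    exact (hqc t).trans hc
  have hεε : ε * ε = 1 := by rcases hε with rfl | rfl <;> norm_num
  have hp := ContinuousMap.norm_update_le_one hqn (τ n) (a := ε)
    (by rcases hε with rfl | rfl <;> simp)
  set p := q.update (τ n) ε with hpdef
  have hpn : p (τ n) = ε := ContinuousMap.update_self _ _ _
  have hpt : ∀ {t : K}, t ≠ τ n → p t = q t := fun ht => ContinuousMap.update_of_ne _ _ ht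
  obtain ⟨f, hf, hfp⟩ := Q.exists_apply_eq hp
  have hG : G f = p := by
    refine Q.inv_eq_of_lowerBound hL hb hf hfp (hx.update (τ n) hε) (fun t => ?_) (fun t => ?_)
    · by_cases ht : t = τ n
      · rw [ht, hpn, ContinuousMap.update_self, hεε]
        exact hbc.trans hc
      · rw [hpt ht, ContinuousMap.update_of_ne _ _ ht, hqx]
        exact hqb t
    · by_cases ht : t = τ n
      · right
        rw [ht, hpn, ContinuousMap.update_self, hεε]
      · left
        rw [hpt ht, ContinuousMap.update_of_ne _ _ ht, hqx]
        exact hqc t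
  refine Q.min_le_mul_map_apply hh hp n hε hc hpn ?_ fun t ht => ?_
  · rw [← hG, Q.right_inv f hf, hfp, hpn]
  · have h1 := hle t ht
    have h2 := abs_le.1 (ContinuousMap.abs_apply_le_one hh t)
    have h3 : h t * x t ≤ 1 := by rcases hx t with h | h <;> rw [h] <;> linarith
    have h4 : |h t * x t - max b (min (h t * x t) c)| ≤ 1 - c := by
      rw [abs_le]
      rcases max_cases b (min (h t * x t) c) with h5 | h5 <;>
        rcases min_cases (h t * x t) c with h6 | h6 <;> constructor <;> linarith
    have h5 : h t - p t = (h t * x t - max b (min (h t * x t) c)) * x t := by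
      rw [hpt ht, sub_mul, mul_assoc, hx.mul_self, mul_one, hqv, mul_comm (x t)]
    rw [h5, abs_mul, hx.abs_eq, mul_one]
    exact h4

theorem lowerBound [Countable K] (Q : NormalizedPair F G τ) {b c : ℝ} (hb : 0 < b) (hc0 : 0 < c)
    (hc1 : c < 1) : LowerBound F τ c b := by
  set η := min b c with hη
  have hη0 : 0 < η := lt_min hb hc0
  have h1 : ∀ j : ℕ, LowerBound F τ c (max η (c - j * (1 - c))) := by
    intro j
    induction j with
    | zero => simpa [hη] using Q.lowerBound_self hc1.le
    | succ j ih =>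
      refine ih.step Q (hη0.trans_le (le_max_left _ _)) (max_le (min_le_right _ _) ?_) hc1.le ?_
      · have : 0 ≤ (j : ℝ) * (1 - c) := mul_nonneg (Nat.cast_nonneg j) (by linarith)
        linarith
      · push_cast
        rcases max_cases η (c - j * (1 - c)) with h | h
        · linarith [le_max_left η (c - (j + 1) * (1 - c))]
        · linarith [le_max_right η (c - (j + 1) * (1 - c))]
  obtain ⟨j, hj⟩ := exists_nat_ge (c / (1 - c))
  have h2 := h1 j
  rw [max_eq_left] at h2
  · exact fun h x n ε hh hx hε hle =>
      h2 h x n ε hh hx hε fun t ht => (min_le_left _ _).trans (hle t ht)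
  · rw [div_le_iff₀ (by linarith)] at hj
    linarith

/-! ### Conclusion -/

theorem map_apply_of_ne_zero [Countable K] (Q : NormalizedPair F G τ) {h : C(K, ℝ)} (hh : ‖h‖ ≤ 1)
    (h0 : ∀ t, h t ≠ 0) (n : IsolatedPoint K) : F h n = h (τ n) := by
  obtain ⟨x, hx, hxh⟩ := ContinuousMap.exists_isSignFunction_mul_eq_abs h0
  obtain ⟨t₀, -, ht₀⟩ := isCompact_univ.exists_isMinOn ⟨(n : K), mem_univ _⟩
    h.continuous.abs.continuousOn
  -- The truncation level `c` is chosen in `(ε * F h n, 1)`.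
  have key : ∀ ε : ℝ, ε = 1 ∨ ε = -1 → ε * h (τ n) ≤ ε * F h n := by
    intro ε hε
    by_contra! hlt
    have h1 := abs_le.1 (ContinuousMap.abs_apply_le_one hh (τ n))
    have h2 : ε * h (τ n) ≤ 1 := by rcases hε with rfl | rfl <;> linarith
    have h3 := Q.lowerBound (b := |h t₀|) (c := max (1 / 2) ((ε * F h n + 1) / 2))
      (abs_pos.2 (h0 _)) (lt_of_lt_of_le (by norm_num) (le_max_left _ _))
      (max_lt (by norm_num) (by linarith)) h x n ε hh hx hε
      (fun t _ => by rw [hxh]; exact ht₀ (mem_univ t))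
    rcases min_le_iff.1 h3 with h4 | h4
    · linarith
    · linarith [le_max_right (1 / 2) ((ε * F h n + 1) / 2)]
  linarith [key 1 (Or.inl rfl), key (-1) (Or.inr rfl)]

theorem map_apply [Countable K] (Q : NormalizedPair F G τ) {h : C(K, ℝ)} (hh : ‖h‖ ≤ 1)
    (n : IsolatedPoint K) : F h n = h (τ n) := by
  refine eq_of_forall_dist_le fun η hη => ?_
  obtain ⟨g, hg, hg0, hgh⟩ := ContinuousMap.exists_forall_ne_zero_norm_sub_le hh (half_pos hη)
  have h1 := Q.map_apply_of_ne_zero hg hg0 n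
  have h2 := abs_le.1 (ContinuousMap.abs_sub_apply_le hgh (τ n))
  have h3 := abs_le.1 (ContinuousMap.abs_sub_apply_le ((Q.norm_sub_le g h hg hh).trans hgh) n)
  rw [Real.dist_eq, abs_le]
  constructor <;> linarith

theorem norm_map_sub_map [Countable K] (Q : NormalizedPair F G τ) {f g : C(K, ℝ)} (hf : ‖f‖ ≤ 1)
    (hg : ‖g‖ ≤ 1) : ‖F f - F g‖ = ‖f - g‖ := by
  refine le_antisymm (Q.norm_sub_le f g hf hg) ((ContinuousMap.norm_le _ (norm_nonneg _)).2
    fun t => ?_)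
  refine Q.dense_image.induction_on t
    (isClosed_le (f - g).continuous.norm continuous_const) fun n => ?_
  rw [ContinuousMap.sub_apply, ← Q.map_apply hf, ← Q.map_apply hg]
  exact ContinuousMap.abs_sub_apply_le le_rfl _

end NormalizedPair

/-- Multiplication by the sign function `G 1` reduces to the case `G 1 = 1`. -/
theorem NonexpansivePair.norm_map_sub_map {K : Type*} [TopologicalSpace K] [CompactSpace K]
    [T2Space K] [Countable K] {F G : C(K, ℝ) → C(K, ℝ)} (P : NonexpansivePair F G) {f g : C(K, ℝ)}
    (hf : ‖f‖ ≤ 1) (hg : ‖g‖ ≤ 1) : ‖F f - F g‖ = ‖f - g‖ := by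
  have hx := P.isSignFunction_inv IsSignFunction.one
  set x := G 1 with hxdef
  have hxx := hx.mul_mul_self
  have hn := hx.norm_mul_le
  obtain ⟨τ, Q⟩ := (P.mul_right hx).exists_normalizedPair
    (by ext t; exact hx.mul_self t) denseRange_isolatedPoint
  have h1 := Q.norm_map_sub_map ((hn f).trans hf) ((hn g).trans hg)
  simp only [hxx] at h1
  refine le_antisymm (P.norm_sub_le f g hf hg) ?_
  rw [h1, ← mul_sub]
  conv_lhs => rw [← hxx (f - g)]
  exact hn _

/-- `C(K, ℝ)` carries the supremum norm, and `F` is a homeomorphism of its closed unit ball onto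
itself for the norm topology. Non-expansive means `1`-Lipschitz. -/
theorem corollary1p3 {K : Type*} [TopologicalSpace K] [CompactSpace K] [T2Space K] [Countable K]
    (F : Metric.closedBall (0 : C(K, ℝ)) 1 ≃ₜ Metric.closedBall (0 : C(K, ℝ)) 1)
    (hF : LipschitzWith 1 F) :
    Isometry F := by
  classical
  have hm : ∀ {f : C(K, ℝ)}, ‖f‖ ≤ 1 → f ∈ Metric.closedBall (0 : C(K, ℝ)) 1 :=
    fun hf => mem_closedBall_zero_iff.2 hf
  set F' : C(K, ℝ) → C(K, ℝ) := fun f => if h : ‖f‖ ≤ 1 then F ⟨f, hm h⟩ else 0 with hF'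
  set G' : C(K, ℝ) → C(K, ℝ) := fun f => if h : ‖f‖ ≤ 1 then F.symm ⟨f, hm h⟩ else 0 with hG'
  have eF : ∀ f (h : ‖f‖ ≤ 1), F' f = F ⟨f, hm h⟩ := fun f h => dif_pos h
  have eG : ∀ f (h : ‖f‖ ≤ 1), G' f = F.symm ⟨f, hm h⟩ := fun f h => dif_pos h
  have nb : ∀ f : Metric.closedBall (0 : C(K, ℝ)) 1, ‖(f : C(K, ℝ))‖ ≤ 1 := fun f =>
    mem_closedBall_zero_iff.1 f.2
  have P : NonexpansivePair F' G' := by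
    refine ⟨fun f hf => ?_, fun f hf => ?_, fun f hf => ?_, fun f hf => ?_, fun f g hf hg => ?_, ?_⟩
    · rw [eF f hf]; exact nb _
    · rw [eG f hf]; exact nb _
    · rw [eG f hf, eF _ (nb _)]; simp
    · rw [eF f hf, eG _ (nb _)]; simp
    · rw [eF f hf, eF g hg]
      have := hF.dist_le_mul ⟨f, hm hf⟩ ⟨g, hm hg⟩
      rwa [NNReal.coe_one, one_mul, Subtype.dist_eq, Subtype.dist_eq, dist_eq_norm,
        dist_eq_norm] at this
    · rw [continuousOn_iff_continuous_domRestrict]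
      refine (continuous_subtype_val.comp F.symm.continuous).congr fun f => ?_
      exact (eG _ (nb f)).symm
  refine Isometry.of_dist_eq fun f g => ?_
  have h := P.norm_map_sub_map (nb f) (nb g)
  rwa [eF _ (nb f), eF _ (nb g), ← dist_eq_norm, ← dist_eq_norm] at h
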